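/- Let $N\ge 1$ and $k\ge 12$ be integers, and let $$f(z)=q^N+\sum_{n>N}c(n)q^n,\qquad q=e^{2\pi i z},$$ be a cusp form of weight $k$ on $\mathrm{SL}_2(\mathbb Z)$ with real Fourier coefficients, normalized as shown (so $c(N)=1$). Let $C_f$ be a real constant (for example the least one) such that $$|c(n)|\le C_f\,\sigma_0(n)\,n^{\frac{k-1}{2}}\qquad\text{for all } n\ge N,$$ where $\sigma_0(n)$ is the number of divisors of $n$. Suppose that $$\frac{4e^{2\pi}C_f}{(N+1)^{k/4}}+\frac{4e^{2\pi}C_f(2\pi)^{\lfloor k/4\rfloor}\left[\sqrt{k}\,\log(2k)+1\right]}{\lfloor k/4\rfloor!}+\frac{e^{2\pi N}(2\pi N)^{\lfloor k/4\rfloor}}{N^{k-1}\,\lfloor k/4\rfloor!}<\frac{1}{N^{k-1}}\left(e^{-2\pi N}-\frac{(2\pi N)^{k/2}}{(k/2)!}e^{2\pi N}\right),$$ and that $m=\frac k2-1$ satisfies either $m\ge 210$ and $N\le\frac14\log m$, or $m\ge 20$ and $N=1$. (The weight $k$ is even because $f\neq 0$.) Let $\mathcal E_f(z)=\int_z^{i\infty}f(\tau)(\tau-z)^{k-2}\,d\tau$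 be the Eichler integral of $f$ for $z$ in the upper half plane, and let $r_f$ be the period polynomial of $f$, that is, the polynomial of degree at most $k-2$ with $$r_f(z)=\mathcal E_f(z)-z^{k-2}\mathcal E_f\left(-\frac1z\right)$$ for all $z$ in the upper half plane. Then $r_f$ is not the zero polynomial and all its complex zeros lie on the unit circle $|z|=1$. -/

import Mathlib

open UpperHalfPlane Polynomial
open scoped MatrixGroups

/-- The `n`-th Fourier coefficient `c(n)` of a level one cusp form `f = ∑ c(n) q ^ n`,
`q = exp (2 π i z)`. -/
noncomputable def cuspCoeff {k : ℕ} (f : CuspForm 𝒮ℒ (k : ℤ)) (n : ℕ) : ℂ :=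
  (qExpansion 1 f).coeff n

/-- The Eichler integral `∫_z^{i∞} f(τ) (τ - z) ^ (k - 2) dτ`, taken along the vertical ray
`τ = z + i t`, `t > 0` (so that `τ - z = i t` and `dτ = i dt`). -/
noncomputable def eichlerIntegral {k : ℕ} (f : CuspForm 𝒮ℒ (k : ℤ)) (z : ℍ) : ℂ :=
  ∫ t in Set.Ioi (0 : ℝ),
    f (ofComplex ((z : ℂ) + Complex.I * t)) * (Complex.I * t) ^ (k - 2) * Complex.I

/-- `P` is the period polynomial `r_f` of `f`: it has degree at most `k - 2` and
`r_f(z) = E_f(z) - z ^ (k - 2) * E_f(-1 / z)` on the upper half plane, where `E_f` is the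
Eichler integral (`ModularGroup.S • z` is `-1 / z`). -/
def IsPeriodPolynomial {k : ℕ} (f : CuspForm 𝒮ℒ (k : ℤ)) (P : ℂ[X]) : Prop :=
  P.natDegree ≤ k - 2 ∧
    ∀ z : ℍ, P.eval (z : ℂ) =
      eichlerIntegral f z - (z : ℂ) ^ (k - 2) * eichlerIntegral f (ModularGroup.S • z)

/-- There is at most one period polynomial. -/
theorem IsPeriodPolynomial.unique {k : ℕ} {f : CuspForm 𝒮ℒ (k : ℤ)} {P Q : ℂ[X]}
    (hP : IsPeriodPolynomial f P) (hQ : IsPeriodPolynomial f Q) : P = Q := by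
  refine Polynomial.eq_of_infinite_eval_eq P Q (Set.Infinite.mono
    (s := Set.range ((↑) : ℍ → ℂ)) ?_ ?_)
  · rintro _ ⟨z, rfl⟩
    exact (hP.2 z).trans (hQ.2 z).symm
  · exact Set.infinite_range_of_injective fun _ _ h => UpperHalfPlane.ext h

/-- A nonzero polynomial all of whose zeros lie on the unit circle. -/
def IsUnimodular (P : ℂ[X]) : Prop :=
  P ≠ 0 ∧ ∀ z : ℂ, P.IsRoot z → ‖z‖ = 1

/-- The conditions on `m` and `N` under which the reversed truncated exponential series
`z ^ m * ∑_{n ≤ m} (2 π N / z) ^ n / n!` is considered. -/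
def TruncExpCriteria (m N : ℕ) : Prop :=
  (210 ≤ m ∧ 1 ≤ N ∧ (N : ℝ) ≤ 1 / 4 * Real.log m) ∨ (20 ≤ m ∧ N = 1)

/-!
On the imaginary axis the Eichler integral is `∫_y^∞ f(it) (t - y) ^ (k - 2) dt` up to a constant.
The functional equation of `t ↦ f(it)` turns the term at `-1 / z` into the missing part `∫_0^y`,
so there `r_f` is a polynomial whose coefficients are moments of `f(it)`, that is, critical values
of `L(f, s)`; by the identity theorem this holds on the whole upper half plane.

With `k = 2 * m + 2` and `x = i z`, `r_f` is a multiple of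
`p(x) = ∑ j ≤ 2 m, (2 π x) ^ j / j! * L(f, 2 m + 1 - j)`, and the functional equation makes `p`
self-inversive: `p(x) = A(x) + x ^ m * B(x)` with `A` its lower half, half of the middle term
included, and `‖B‖ = ‖A‖` on the unit circle. If `A` has no zero in the closed unit disc, the
maximum principle for `B / A` shows that `p` has no zero in the open disc, and by symmetry none
outside the closed disc.

For `j` well below `m` the Dirichlet series gives `L(f, 2 m + 1 - j) ≈ N ^ -(2 m + 1 - j)`, so
`A(x)` is close to `N ^ -(2 m + 1)` times a truncation of `exp (2 π N x)`, whose modulus on the disc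
is at least `exp (-2 π N)` minus a tail. The numerical hypothesis says that this minimum exceeds all
the errors. The bound `σ₀(n) ≤ 2 √n` is precise enough for every error term.
-/

section Elementary

theorem card_divisors_le_two_mul_sqrt (n : ℕ) : n.divisors.card ≤ 2 * n.sqrt := by
  have hsub : n.divisors ⊆ Finset.Icc 1 n.sqrt ∪ (Finset.Icc 1 n.sqrt).image (n / ·) := by
    intro d hd
    have hdn := Nat.dvd_of_mem_divisors hd
    have hd0 := Nat.pos_of_mem_divisors hd
    have hn := Nat.pos_of_ne_zero (Nat.ne_zero_of_mem_divisors hd)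
    rw [Finset.mem_union, Finset.mem_image]
    rcases le_or_gt d n.sqrt with h | h
    · exact Or.inl (Finset.mem_Icc.2 ⟨hd0, h⟩)
    · refine Or.inr ⟨n / d, Finset.mem_Icc.2
        ⟨Nat.div_pos (Nat.le_of_dvd hn hdn) hd0, ?_⟩, Nat.div_div_self hdn hn.ne'⟩
      exact Nat.lt_succ_iff.1 (Nat.div_lt_of_lt_mul
        ((Nat.lt_succ_sqrt n).trans_le (Nat.mul_le_mul_right _ h)))
  calc n.divisors.card
      ≤ (Finset.Icc 1 n.sqrt).card + ((Finset.Icc 1 n.sqrt).image (n / ·)).card :=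
        (Finset.card_le_card hsub).trans (Finset.card_union_le _ _)
    _ ≤ (Finset.Icc 1 n.sqrt).card + (Finset.Icc 1 n.sqrt).card :=
        Nat.add_le_add_left Finset.card_image_le _
    _ = 2 * n.sqrt := by rw [Nat.card_Icc, Nat.add_sub_cancel, two_mul]

theorem sigma_zero_le_two_mul_sqrt (n : ℕ) :
    (ArithmeticFunction.sigma 0 n : ℝ) ≤ 2 * Real.sqrt n := by
  rw [ArithmeticFunction.sigma_zero_apply]
  calc (n.divisors.card : ℝ) ≤ 2 * (n.sqrt : ℝ) := mod_cast card_divisors_le_two_mul_sqrt n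
    _ ≤ 2 * Real.sqrt n := by gcongr; exact Real.nat_sqrt_le_real_sqrt

theorem div_add_one_pow_succ_le_sub {x : ℝ} (hx : 0 < x) (q : ℕ) :
    q / (x + 1) ^ (q + 1) ≤ 1 / x ^ q - 1 / (x + 1) ^ q := by
  have bernoulli : 1 + q * (1 / x) ≤ (1 + 1 / x) ^ q :=
    one_add_mul_le_pow (by linarith [one_div_pos.2 hx]) q
  calc q / (x + 1) ^ (q + 1) = q * (1 / (x + 1)) / (x + 1) ^ q := by rw [pow_succ]; field_simp
    _ ≤ q * (1 / x) / (x + 1) ^ q := by gcongr; linarith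
    _ ≤ ((1 + 1 / x) ^ q - 1) / (x + 1) ^ q := by gcongr; linarith
    _ = 1 / x ^ q - 1 / (x + 1) ^ q := by
        rw [sub_div, show 1 + 1 / x = (x + 1) / x by field_simp, div_pow]
        field_simp

theorem tsum_one_div_nat_add_pow_succ_le {M q : ℕ} (hM : M ≠ 0) (hq : q ≠ 0) :
    ∑' n : ℕ, 1 / ((n + M : ℕ) : ℝ) ^ (q + 1) ≤ (1 + M / q) / (M : ℝ) ^ (q + 1) := by
  have telescope (n : ℕ) : ∑ i ∈ Finset.range n, 1 / ((i + 1 + M : ℕ) : ℝ) ^ (q + 1) ≤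
      1 / q * (1 / (M : ℝ) ^ q) := by
    calc ∑ i ∈ Finset.range n, 1 / ((i + 1 + M : ℕ) : ℝ) ^ (q + 1)
        ≤ ∑ i ∈ Finset.range n, 1 / q * (1 / ((i + M : ℕ) : ℝ) ^ q -
            1 / ((i + 1 + M : ℕ) : ℝ) ^ q) := by
          refine Finset.sum_le_sum fun i _ => ?_
          have h := div_add_one_pow_succ_le_sub (x := (i + M : ℕ)) (by positivity) q
          rw [show ((i + M : ℕ) : ℝ) + 1 = (i + 1 + M : ℕ) by push_cast; ring] at h
          rw [one_div_mul_eq_div, le_div_iff₀ (by positivity), one_div_mul_eq_div]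
          exact h
      _ = 1 / q * (1 / (M : ℝ) ^ q - 1 / ((n + M : ℕ) : ℝ) ^ q) := by
          rw [← Finset.mul_sum, Finset.sum_range_sub' fun i => 1 / ((i + M : ℕ) : ℝ) ^ q, zero_add]
      _ ≤ 1 / q * (1 / (M : ℝ) ^ q) := by
          gcongr; exact sub_le_self _ (by positivity)
  refine Real.tsum_le_of_sum_range_le (fun n => by positivity) fun n => ?_
  calc ∑ i ∈ Finset.range n, 1 / ((i + M : ℕ) : ℝ) ^ (q + 1)
      ≤ ∑ i ∈ Finset.range (n + 1), 1 / ((i + M : ℕ) : ℝ) ^ (q + 1) :=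
        Finset.sum_le_sum_of_subset_of_nonneg (Finset.range_mono n.le_succ)
          fun _ _ _ => by positivity
    _ ≤ 1 / q * (1 / (M : ℝ) ^ q) + 1 / (M : ℝ) ^ (q + 1) := by
        rw [Finset.sum_range_succ', zero_add]; gcongr; exact telescope n
    _ = (1 + M / q) / (M : ℝ) ^ (q + 1) := by rw [pow_succ]; field_simp; ring

theorem norm_le_of_hasSum_of_norm_le_div_pow {E : Type*} [NormedAddCommGroup E] {u : ℕ → E}
    {S : E} (hu : HasSum u S) {B : ℝ} {M q : ℕ} (hM : M ≠ 0) (hMq : M ≤ q)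
    (hu0 : ∀ n < M, u n = 0) (hle : ∀ n ≥ M, ‖u n‖ ≤ B / (n : ℝ) ^ (q + 1)) :
    ‖S‖ ≤ 2 * B / (M : ℝ) ^ (q + 1) := by
  have hM' : (0 : ℝ) < M := by positivity
  have hq : (0 : ℝ) < q := hM'.trans_le (mod_cast hMq)
  have hB : 0 ≤ B := by
    have h := (norm_nonneg _).trans (hle M le_rfl)
    contrapose! h
    exact div_neg_of_neg_of_pos h (by positivity)
  have hshift : HasSum (fun n => u (n + M)) S := by
    rwa [hasSum_nat_add_iff, Finset.sum_eq_zero fun n hn => hu0 n (Finset.mem_range.1 hn), add_zero]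
  have hsummable : Summable fun n : ℕ => 1 / ((n + M : ℕ) : ℝ) ^ (q + 1) :=
    (summable_nat_add_iff M).2 (Real.summable_one_div_nat_pow.2 (by omega))
  calc ‖S‖ = ‖∑' n, u (n + M)‖ := by rw [hshift.tsum_eq]
    _ ≤ B * ∑' n : ℕ, 1 / ((n + M : ℕ) : ℝ) ^ (q + 1) := by
        rw [← tsum_mul_left]
        refine tsum_of_norm_bounded (hsummable.mul_left B).hasSum fun n => ?_
        rw [mul_one_div]
        exact hle (n + M) (Nat.le_add_left M n)
    _ ≤ B * ((1 + M / q) / (M : ℝ) ^ (q + 1)) := by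
        gcongr; exact tsum_one_div_nat_add_pow_succ_le hM (by omega)
    _ ≤ B * ((1 + 1) / (M : ℝ) ^ (q + 1)) := by
        gcongr; exact div_le_one_of_le₀ (mod_cast hMq) hq.le
    _ = 2 * B / (M : ℝ) ^ (q + 1) := by ring

theorem pow_div_factorial_le_mul {x : ℝ} (hx : 0 ≤ x) (J i : ℕ) :
    x ^ (J + i) / (J + i).factorial ≤ x ^ J / J.factorial * (x ^ i / i.factorial) := by
  rw [div_mul_div_comm, ← pow_add]
  gcongr
  exact_mod_cast Nat.le_of_dvd (Nat.factorial_pos _)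
    (Nat.factorial_mul_factorial_dvd_factorial_add J i)

theorem sum_Ico_pow_div_factorial_le {x : ℝ} (hx : 0 ≤ x) (J n : ℕ) :
    ∑ j ∈ Finset.Ico J n, x ^ j / j.factorial ≤ x ^ J / J.factorial * Real.exp x := by
  calc ∑ j ∈ Finset.Ico J n, x ^ j / j.factorial
      ≤ ∑ i ∈ Finset.range (n - J), x ^ J / J.factorial * (x ^ i / i.factorial) := by
        rw [Finset.sum_Ico_eq_sum_range]
        exact Finset.sum_le_sum fun i _ => pow_div_factorial_le_mul hx J i
    _ = x ^ J / J.factorial * ∑ i ∈ Finset.range (n - J), x ^ i / i.factorial := by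
        rw [Finset.mul_sum]
    _ ≤ x ^ J / J.factorial * Real.exp x := by gcongr; exact Real.sum_le_exp_of_nonneg hx _

theorem exp_sub_sum_range_le {x : ℝ} (hx : 0 ≤ x) (n : ℕ) :
    Real.exp x - ∑ j ∈ Finset.range n, x ^ j / j.factorial ≤ x ^ n / n.factorial * Real.exp x := by
  have hlim := (NormedSpace.expSeries_div_hasSum_exp (𝔸 := ℝ) x).tendsto_sum_nat
  rw [← Real.exp_eq_exp_ℝ] at hlim
  rw [sub_le_iff_le_add]
  refine le_of_tendsto hlim (Filter.eventually_atTop.2 ⟨n, fun l hl => ?_⟩)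
  rw [← Finset.sum_range_add_sum_Ico _ hl]
  linarith [sum_Ico_pow_div_factorial_le hx n l]

theorem exp_neg_sub_le_norm_sum_range_pow_div_factorial {R : ℝ} {w : ℂ} (hw : ‖w‖ ≤ R) (n : ℕ) :
    Real.exp (-R) - R ^ n / n.factorial * Real.exp R ≤
      ‖∑ j ∈ Finset.range n, w ^ j / j.factorial‖ := by
  have hR : 0 ≤ R := (norm_nonneg w).trans hw
  have hexp : Real.exp (-R) ≤ ‖Complex.exp w‖ := by
    rw [Complex.norm_exp, Real.exp_le_exp]
    exact (abs_le.1 ((Complex.abs_re_le_norm w).trans hw)).1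
  have htail : ‖Complex.exp w - ∑ j ∈ Finset.range n, w ^ j / j.factorial‖ ≤
      R ^ n / n.factorial * Real.exp R :=
    calc _ ≤ Real.exp ‖w‖ - ∑ j ∈ Finset.range n, ‖w‖ ^ j / j.factorial :=
          Complex.norm_exp_sub_sum_le_exp_norm_sub_sum w n
      _ ≤ ‖w‖ ^ n / n.factorial * Real.exp ‖w‖ := exp_sub_sum_range_le (norm_nonneg w) n
      _ ≤ R ^ n / n.factorial * Real.exp R := by gcongr
  linarith [norm_sub_norm_le (Complex.exp w) (∑ j ∈ Finset.range n, w ^ j / j.factorial)]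

end Elementary

section SelfInversive

open scoped ComplexConjugate

/-- The coefficient sequence `a` of a polynomial `∑ j ≤ n, a j * X ^ j` is self-inversive with
multiplier `ε`, i.e. the polynomial agrees up to `ε` with its conjugate reversal. -/
def IsSelfInversive (n : ℕ) (ε : ℂ) (a : ℕ → ℂ) : Prop :=
  ‖ε‖ = 1 ∧ ∀ j ≤ n, a (n - j) = ε * conj (a j)

/-- The lower half of a polynomial `∑ j ≤ 2 * m, a j * X ^ j`, including half of its middle term. -/
noncomputable def halfSum (m : ℕ) (a : ℕ → ℂ) (x : ℂ) : ℂ :=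
  ∑ j ∈ Finset.range m, a j * x ^ j + a m / 2 * x ^ m

/-- The conjugate reversal of `halfSum m a`, as a polynomial of degree at most `m`. -/
noncomputable def halfSumRev (m : ℕ) (a : ℕ → ℂ) (x : ℂ) : ℂ :=
  ∑ j ∈ Finset.range m, conj (a j) * x ^ (m - j) + conj (a m) / 2

variable {m : ℕ} {a : ℕ → ℂ} {ε : ℂ}

theorem IsSelfInversive.sum_eq_halfSum_add (ha : IsSelfInversive (2 * m) ε a) (x : ℂ) :
    ∑ j ∈ Finset.range (2 * m + 1), a j * x ^ j =
      halfSum m a x + x ^ m * (ε * halfSumRev m a x) := by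
  have hmid : a m = ε * conj (a m) := by
    simpa only [two_mul, Nat.add_sub_cancel] using ha.2 m (by omega)
  have hupper : ∑ j ∈ Finset.Ico (m + 1) (2 * m + 1), a j * x ^ j =
      x ^ m * (ε * ∑ j ∈ Finset.range m, conj (a j) * x ^ (m - j)) := by
    rw [Finset.sum_Ico_eq_sum_range, show 2 * m + 1 - (m + 1) = m by omega,
      ← Finset.sum_range_reflect, Finset.mul_sum, Finset.mul_sum]
    refine Finset.sum_congr rfl fun j hj => ?_
    have hj := Finset.mem_range.1 hj
    rw [show m + 1 + (m - 1 - j) = 2 * m - j by omega, ha.2 j (by omega),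
      show 2 * m - j = m + (m - j) by omega, pow_add]
    ring
  rw [← Finset.sum_range_add_sum_Ico _ (show m ≤ 2 * m + 1 by omega),
    Finset.sum_eq_sum_Ico_succ_bot (show m < 2 * m + 1 by omega), hupper, halfSum, halfSumRev]
  linear_combination x ^ m / 2 * hmid

theorem IsSelfInversive.sum_eq_mul_conj (ha : IsSelfInversive (2 * m) ε a) {x : ℂ} (hx : x ≠ 0) :
    ∑ j ∈ Finset.range (2 * m + 1), a j * x ^ j =
      ε * x ^ (2 * m) * conj (∑ j ∈ Finset.range (2 * m + 1), a j * (conj x)⁻¹ ^ j) := by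
  rw [← Finset.sum_range_reflect, map_sum, Finset.mul_sum]
  refine Finset.sum_congr rfl fun j hj => ?_
  have hj : j ≤ 2 * m := Nat.lt_succ_iff.1 (Finset.mem_range.1 hj)
  rw [show 2 * m + 1 - 1 - j = 2 * m - j by omega, ha.2 j hj, map_mul, map_pow, map_inv₀,
    Complex.conj_conj, inv_pow, pow_sub₀ _ hx hj]
  ring

theorem norm_halfSumRev {z : ℂ} (hz : ‖z‖ = 1) : ‖halfSumRev m a z‖ = ‖halfSum m a z‖ := by
  have hzz : z * conj z = 1 := by simp [Complex.mul_conj, Complex.normSq_eq_norm_sq, hz]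
  have hpow {j : ℕ} (hj : j ≤ m) : z ^ m * conj z ^ j = z ^ (m - j) := by
    rw [← Nat.sub_add_cancel hj, pow_add, mul_assoc, ← mul_pow, hzz, one_pow, mul_one,
      Nat.add_sub_cancel]
  have hrev : halfSumRev m a z = z ^ m * conj (halfSum m a z) := by
    rw [halfSumRev, halfSum, map_add, map_sum, mul_add, Finset.mul_sum]
    congr 1
    · refine Finset.sum_congr rfl fun j hj => ?_
      rw [map_mul, map_pow, mul_left_comm, hpow (Finset.mem_range.1 hj).le]
    · rw [map_mul, map_pow, mul_left_comm, hpow le_rfl, Nat.sub_self, pow_zero, mul_one,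
        map_div₀, map_ofNat]
  rw [hrev, norm_mul, norm_pow, hz, one_pow, one_mul, RCLike.norm_conj]

theorem add_pow_mul_ne_zero_of_norm_le_on_circle {A B : ℂ → ℂ} (hA : Differentiable ℂ A)
    (hB : Differentiable ℂ B) (hA0 : ∀ z, ‖z‖ ≤ 1 → A z ≠ 0)
    (hAB : ∀ z, ‖z‖ = 1 → ‖B z‖ ≤ ‖A z‖) (hm : m ≠ 0) {z : ℂ} (hz : ‖z‖ < 1) :
    A z + z ^ m * B z ≠ 0 := by
  have hBA : ‖B z / A z‖ ≤ 1 := by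
    refine Complex.norm_le_of_forall_mem_frontier_norm_le (f := fun w => B w / A w)
      (Metric.isBounded_ball (x := (0 : ℂ)) (r := 1)) (DifferentiableOn.diffContOnCl ?_)
      (fun w hw => ?_) (subset_closure (by simpa using hz))
    · rw [closure_ball _ one_ne_zero]
      exact hB.differentiableOn.div hA.differentiableOn fun w hw => hA0 w (by simpa using hw)
    · rw [frontier_ball _ one_ne_zero, mem_sphere_zero_iff_norm] at hw
      rw [norm_div]
      exact div_le_one_of_le₀ (hAB w hw) (norm_nonneg _)
  have hAz : 0 < ‖A z‖ := norm_pos_iff.2 (hA0 z hz.le)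
  rw [norm_div, div_le_one hAz] at hBA
  have hlt : ‖z ^ m * B z‖ < ‖A z‖ := by
    calc ‖z ^ m * B z‖ = ‖z‖ ^ m * ‖B z‖ := by rw [norm_mul, norm_pow]
      _ ≤ ‖z‖ ^ m * ‖A z‖ := by gcongr
      _ < ‖A z‖ := mul_lt_of_lt_one_left hAz (pow_lt_one₀ (norm_nonneg _) hz hm)
  intro h
  rw [eq_neg_of_add_eq_zero_left h, norm_neg] at hlt
  exact lt_irrefl _ hlt

theorem IsSelfInversive.norm_eq_one_of_sum_eq_zero (ha : IsSelfInversive (2 * m) ε a)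
    (hm : m ≠ 0) (hhalf : ∀ x : ℂ, ‖x‖ ≤ 1 → halfSum m a x ≠ 0) {x : ℂ}
    (hx : ∑ j ∈ Finset.range (2 * m + 1), a j * x ^ j = 0) : ‖x‖ = 1 := by
  have hdisc (y : ℂ) (hy : ‖y‖ < 1) : ∑ j ∈ Finset.range (2 * m + 1), a j * y ^ j ≠ 0 := by
    rw [ha.sum_eq_halfSum_add]
    refine add_pow_mul_ne_zero_of_norm_le_on_circle (A := halfSum m a)
      (B := fun z => ε * halfSumRev m a z) ?_ ?_ hhalf (fun z hz => ?_) hm hy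
    · unfold halfSum; fun_prop
    · unfold halfSumRev; fun_prop
    · rw [norm_mul, ha.1, one_mul, norm_halfSumRev hz]
  rcases lt_trichotomy ‖x‖ 1 with h | h | h
  · exact absurd hx (hdisc x h)
  · exact h
  · have hx0 : x ≠ 0 := norm_pos_iff.1 (one_pos.trans h)
    have hε : ε ≠ 0 := norm_pos_iff.1 (ha.1 ▸ one_pos)
    have hinv : ‖(conj x)⁻¹‖ < 1 := by
      rw [norm_inv, RCLike.norm_conj]; exact inv_lt_one_of_one_lt₀ h
    rw [ha.sum_eq_mul_conj hx0] at hx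
    have hx := (mul_eq_zero.1 hx).resolve_left (mul_ne_zero hε (pow_ne_zero _ hx0))
    exact absurd ((map_eq_zero _).1 hx) (hdisc _ hinv)

end SelfInversive

section HalfLine

open MeasureTheory Set
open scoped Pointwise

theorem integral_Ioi_comp_add_right {E : Type*} [NormedAddCommGroup E] [NormedSpace ℝ E]
    (g : ℝ → E) (a y : ℝ) : ∫ t in Ioi a, g (t + y) = ∫ t in Ioi (a + y), g t := by
  have h := (measurePreserving_add_right volume y).setIntegral_preimage_emb
    (measurableEmbedding_addRight y) g (Ioi (a + y))
  rwa [preimage_add_const_Ioi, add_sub_cancel_right] at h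

theorem setIntegral_inv_eq {E : Type*} [NormedAddCommGroup E] [NormedSpace ℝ E] {s : Set ℝ}
    (hs : MeasurableSet s) (hs0 : s ⊆ Ioi 0) (g : ℝ → E) :
    ∫ t in s⁻¹, g t = ∫ t in s, (t ^ 2)⁻¹ • g t⁻¹ := by
  rw [← image_inv_eq_inv, integral_image_eq_integral_abs_deriv_smul hs
    (fun t ht => (hasDerivAt_inv (hs0 ht).ne').hasDerivWithinAt) inv_injective.injOn]
  refine setIntegral_congr_fun hs fun t _ => ?_
  simp only [abs_neg, abs_inv, abs_of_nonneg (sq_nonneg t)]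

theorem integral_Ioi_zero_eq_integral_inv {E : Type*} [NormedAddCommGroup E] [NormedSpace ℝ E]
    (g : ℝ → E) : ∫ t in Ioi (0 : ℝ), g t = ∫ t in Ioi (0 : ℝ), (t ^ 2)⁻¹ • g t⁻¹ := by
  rw [← setIntegral_inv_eq measurableSet_Ioi Subset.rfl]
  congr 2
  ext t
  simp

theorem integral_norm_le_tsum_integral_norm {α E : Type*} [MeasurableSpace α] {μ : Measure α}
    [NormedAddCommGroup E] {F : ℕ → α → E} {G : α → E} (hF : ∀ n, Integrable (F n) μ)
    (hsum : Summable fun n => ∫ x, ‖F n x‖ ∂μ) (hFG : ∀ᵐ x ∂μ, HasSum (F · x) (G x)) :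
    ∫ x, ‖G x‖ ∂μ ≤ ∑' n, ∫ x, ‖F n x‖ ∂μ := by
  have hnonneg (n : ℕ) : 0 ≤ ∫ x, ‖F n x‖ ∂μ := integral_nonneg fun _ => norm_nonneg _
  by_cases hG : Integrable (fun x => ‖G x‖) μ
  swap
  · rw [integral_undef hG]; exact tsum_nonneg hnonneg
  rw [← ENNReal.ofReal_le_ofReal_iff (tsum_nonneg hnonneg),
    ofReal_integral_eq_lintegral_ofReal hG (.of_forall fun _ => norm_nonneg _),
    ENNReal.ofReal_tsum_of_nonneg hnonneg hsum]
  calc ∫⁻ x, ENNReal.ofReal ‖G x‖ ∂μ ≤ ∫⁻ x, ∑' n, ‖F n x‖ₑ ∂μ := by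
        refine lintegral_mono_ae (hFG.mono fun x hx => ?_)
        rw [ofReal_norm, ← hx.tsum_eq]
        exact enorm_tsum_le_tsum_enorm
    _ = ∑' n, ∫⁻ x, ‖F n x‖ₑ ∂μ := lintegral_tsum fun n => (hF n).1.enorm
    _ = ∑' n, ENNReal.ofReal (∫ x, ‖F n x‖ ∂μ) :=
        tsum_congr fun n => (ofReal_integral_norm_eq_lintegral_enorm (hF n)).symm

theorem integral_pow_mul_exp_neg_mul (p : ℕ) {a : ℝ} (ha : 0 < a) :
    ∫ t in Ioi (0 : ℝ), t ^ p * Real.exp (-a * t) = p.factorial / a ^ (p + 1) := by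
  have h := Real.integral_rpow_mul_exp_neg_mul_Ioi (a := p + 1) (r := a) (by positivity) ha
  rw [Real.Gamma_nat_eq_factorial, add_sub_cancel_right] at h
  simp only [Real.rpow_natCast, ← neg_mul] at h
  rw [h, ← Nat.cast_succ, Real.rpow_natCast, div_pow, one_pow, one_div_mul_eq_div]

theorem integrableOn_pow_mul_exp_neg_mul (p : ℕ) {a : ℝ} (ha : 0 < a) :
    IntegrableOn (fun t : ℝ => t ^ p * Real.exp (-a * t)) (Ioi 0) := by
  refine .of_integral_ne_zero ?_
  rw [integral_pow_mul_exp_neg_mul p ha]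
  positivity

end HalfLine

section CuspForms

open MeasureTheory Set
open scoped Real ComplexConjugate

section AnyWeight

variable {k : ℕ} (f : CuspForm 𝒮ℒ (k : ℤ))

theorem cuspCoeff_zero : cuspCoeff f 0 = 0 :=
  CuspFormClass.qExpansion_coeff_zero f one_pos one_mem_strictPeriods_SL

variable {f} in
theorem ne_zero_of_cuspCoeff_eq_one {n : ℕ} (hn : cuspCoeff f n = 1) : n ≠ 0 := by
  rintro rfl
  exact zero_ne_one ((cuspCoeff_zero f).symm.trans hn)

theorem even_of_cuspCoeff_ne_zero {n : ℕ} (hn : cuspCoeff f n ≠ 0) : Even k := by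
  contrapose! hn
  have hf : (f : ℍ → ℂ) = 0 := funext fun z => DFunLike.congr_fun
    (ModularForm.levelOne_odd_weight_eq_zero (mod_cast Nat.not_even_iff_odd.1 hn)
      (f : ModularForm 𝒮ℒ k)) z
  rw [cuspCoeff, hf, qExpansion_zero, map_zero]

theorem cuspForm_S_smul (z : ℍ) : f (ModularGroup.S • z) = (z : ℂ) ^ k * f z := by
  have h := SlashInvariantForm.slash_action_eqn'' f
    (γ := (ModularGroup.S : GL (Fin 2) ℝ)) (MonoidHom.mem_range.2 ⟨ModularGroup.S, rfl⟩) z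
  rw [ModularGroup.denom_S] at h
  exact_mod_cast h

theorem hasSum_cuspCoeff_mul_exp {w : ℂ} (hw : 0 ≤ w.im) {t : ℝ} (ht : 0 < t) :
    HasSum (fun n : ℕ => cuspCoeff f n * Complex.exp (2 * π * Complex.I * n * w) *
      (Real.exp (-(2 * π * n) * t) : ℝ)) (f (ofComplex (w + Complex.I * t))) := by
  have him : 0 < (w + Complex.I * t).im := by simpa using add_pos_of_nonneg_of_pos hw ht
  have h := ModularForm.hasSum_qExpansion f one_pos one_mem_strictPeriods_SL
    (ofComplex (w + Complex.I * t))
  refine h.congr_fun fun n => ?_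
  rw [Function.Periodic.qParam, ← Complex.exp_nat_mul,
    ofComplex_apply_of_im_pos him, mul_assoc, Complex.ofReal_exp, ← Complex.exp_add, cuspCoeff]
  congr 2
  push_cast
  linear_combination (-2 * π * n * t : ℂ) * Complex.I_sq

/-- The restriction `t ↦ f(it)` of `f` to the imaginary axis; only its values at `t > 0` are
meaningful. -/
noncomputable def onImag (t : ℝ) : ℂ := f (ofComplex (Complex.I * t))

theorem hasSum_onImag {t : ℝ} (ht : 0 < t) :
    HasSum (fun n : ℕ => cuspCoeff f n * (Real.exp (-(2 * π * n) * t) : ℝ)) (onImag f t) := by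
  simpa only [onImag, mul_zero, Complex.exp_zero, mul_one, zero_add] using
    hasSum_cuspCoeff_mul_exp f (w := 0) le_rfl ht

theorem onImag_inv {t : ℝ} (ht : 0 < t) :
    onImag f t⁻¹ = Complex.I ^ k * t ^ k * onImag f t := by
  have him : 0 < (Complex.I * t).im := by simpa using ht
  have hS : ModularGroup.S • ofComplex (Complex.I * t) = ofComplex (Complex.I * (t⁻¹ : ℝ)) := by
    ext
    rw [modular_S_smul, ofComplex_apply_of_im_pos him,
      ofComplex_apply_of_im_pos (by simpa using ht)]
    change (-(Complex.I * t))⁻¹ = Complex.I * (t⁻¹ : ℝ)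
    rw [inv_neg, mul_inv, Complex.inv_I, neg_mul, neg_neg, Complex.ofReal_inv]
  rw [onImag, ← hS, cuspForm_S_smul, ofComplex_apply_of_im_pos him, mul_pow, onImag,
    ofComplex_apply_of_im_pos him]

theorem conj_onImag (hreal : ∀ n, (cuspCoeff f n).im = 0) {t : ℝ} (ht : 0 < t) :
    conj (onImag f t) = onImag f t := by
  refine ((hasSum_onImag f ht).map conj Complex.continuous_conj).unique
    ((hasSum_onImag f ht).congr_fun fun n => ?_)
  rw [Function.comp_apply, map_mul, Complex.conj_ofReal, Complex.conj_eq_iff_im.2 (hreal n)]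

end AnyWeight

variable {m : ℕ} (f : CuspForm 𝒮ℒ ((2 * m + 2 : ℕ) : ℤ))

theorem integrableOn_pow_mul_onImag (p : ℕ) :
    IntegrableOn (fun t : ℝ => (t : ℂ) ^ p * onImag f t) (Ioi 0) := by
  refine ((CuspForm.isStrongFEPair (by positivity) f).hasMellin (p + 1)).1.congr_fun
    (fun t _ => ?_) measurableSet_Ioi
  simp [onImag]

/-- The moments of `f` along the imaginary axis, i.e. the values at the integers of its
completed `L`-function. -/
noncomputable def moment (p : ℕ) : ℂ := ∫ t in Ioi (0 : ℝ), (t : ℂ) ^ p * onImag f t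

/-- The value `L(f, p + 1)`, indexed so that `p` is the exponent of the corresponding moment and
`0 ≤ p ≤ 2 * m` is the critical range. -/
noncomputable def criticalValue (p : ℕ) : ℂ := ModularForm.L (by positivity) f (p + 1)

theorem criticalValue_eq (p : ℕ) :
    criticalValue f p = (2 * π) ^ (p + 1) / p.factorial * moment f p := by
  have hmoment : ModularForm.Λ (by positivity) f (p + 1) = moment f p := by
    rw [CuspForm.Λ_eq_mellin]
    simp [mellin, moment, onImag]
  rw [criticalValue, ModularForm.L, hmoment, Complex.Gammaℂ_def, Complex.Gamma_nat_eq_factorial,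
    Complex.cpow_neg, ← Nat.cast_succ, Complex.cpow_natCast]
  field_simp

theorem hasSum_criticalValue {p : ℕ} (hp : m + 2 ≤ p) :
    HasSum (fun n : ℕ => cuspCoeff f n / (n : ℂ) ^ (p + 1)) (criticalValue f p) := by
  have hre : (((2 * m + 2 : ℕ) : ℤ) : ℝ) / 2 + 1 < ((p : ℂ) + 1).re := by
    have hp : (m : ℝ) + 2 ≤ p := mod_cast hp
    simp only [Complex.add_re, Complex.natCast_re, Complex.one_re]
    push_cast
    linarith
  have h := CuspForm.hasSum_L (by positivity) f hre
  simp only [Subgroup.strictWidthInfty_SL2Z, Complex.ofReal_one, Complex.one_cpow, one_mul,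
    ← Nat.cast_succ, Complex.cpow_natCast] at h
  rw [criticalValue, ← Nat.cast_succ]
  exact h

theorem moment_symm {p q : ℕ} (hpq : p + q = 2 * m) :
    moment f q = Complex.I ^ (2 * m + 2) * moment f p := by
  rw [moment, integral_Ioi_zero_eq_integral_inv, moment, ← integral_const_mul]
  refine setIntegral_congr_fun measurableSet_Ioi fun t ht => ?_
  have ht0 : (t : ℂ) ≠ 0 := by exact_mod_cast (ne_of_gt ht)
  simp only [onImag_inv f ht, Complex.real_smul, ← hpq]
  push_cast
  rw [inv_pow]
  field_simp
  ring

theorem integral_pow_mul_norm_onImag_symm {p q : ℕ} (hpq : p + q = 2 * m) :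
    ∫ t in Ioi (0 : ℝ), t ^ q * ‖onImag f t‖ = ∫ t in Ioi (0 : ℝ), t ^ p * ‖onImag f t‖ := by
  rw [integral_Ioi_zero_eq_integral_inv]
  refine setIntegral_congr_fun measurableSet_Ioi fun t (ht : 0 < t) => ?_
  simp only [onImag_inv f ht, smul_eq_mul, norm_mul, norm_pow, Complex.norm_I, one_pow, one_mul,
    Complex.norm_real, Real.norm_of_nonneg ht.le, ← hpq, inv_pow]
  field_simp
  ring

theorem conj_moment (hreal : ∀ n, (cuspCoeff f n).im = 0) (p : ℕ) :
    conj (moment f p) = moment f p := by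
  rw [moment, ← integral_conj]
  refine setIntegral_congr_fun measurableSet_Ioi fun t ht => ?_
  simp only [map_mul, map_pow, Complex.conj_ofReal, conj_onImag f hreal ht]

/-- The coefficients of the normalized period polynomial `∑ j ≤ 2 * m, periodCoeff f j * X ^ j`,
which is the period polynomial of `f` up to a constant factor and the rotation `X = I * z`. -/
noncomputable def periodCoeff (j : ℕ) : ℂ :=
  (2 * π) ^ j / j.factorial * criticalValue f (2 * m - j)

theorem periodCoeff_eq {j : ℕ} (hj : j ≤ 2 * m) :
    periodCoeff f j =
      (2 * π) ^ (2 * m + 1) / (j.factorial * (2 * m - j).factorial) * moment f (2 * m - j) := by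
  rw [periodCoeff, criticalValue_eq, show 2 * m + 1 = j + (2 * m - j + 1) by omega, pow_add]
  ring

theorem isSelfInversive_periodCoeff (hreal : ∀ n, (cuspCoeff f n).im = 0) :
    IsSelfInversive (2 * m) (Complex.I ^ (2 * m + 2)) (periodCoeff f) := by
  refine ⟨by rw [norm_pow, Complex.norm_I, one_pow], fun j hj => ?_⟩
  rw [periodCoeff_eq f hj, periodCoeff_eq f (Nat.sub_le _ _), Nat.sub_sub_self hj,
    moment_symm f (Nat.sub_add_cancel hj)]
  simp only [map_mul, map_div₀, map_pow, map_ofNat, map_natCast, Complex.conj_ofReal,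
    conj_moment f hreal]
  ring

end CuspForms

section Eichler

open MeasureTheory Set
open scoped Real

theorem eqOn_upperHalfPlane_of_eqOn_imag {g h : ℂ → ℂ} (hg : DifferentiableOn ℂ g {w | 0 < w.im})
    (hh : DifferentiableOn ℂ h {w | 0 < w.im})
    (hgh : ∀ y : ℝ, 0 < y → g (Complex.I * y) = h (Complex.I * y)) :
    EqOn g h {w | 0 < w.im} := by
  refine AnalyticOnNhd.eqOn_of_preconnected_of_frequently_eq
    (hg.analyticOnNhd isOpen_upperHalfPlaneSet) (hh.analyticOnNhd isOpen_upperHalfPlaneSet)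
    (convex_halfSpace_im_gt 0).isPreconnected (z₀ := Complex.I) (by simp) ?_
  have hlim : Filter.Tendsto (fun y : ℝ => Complex.I * y) (nhdsWithin 1 {1}ᶜ)
      (nhdsWithin Complex.I {Complex.I}ᶜ) := by
    have hcont : Continuous fun y : ℝ => Complex.I * (y : ℂ) := by fun_prop
    have hinj : Function.Injective fun y : ℝ => Complex.I * (y : ℂ) :=
      (mul_right_injective₀ Complex.I_ne_zero).comp Complex.ofReal_injective
    simpa only [Complex.ofReal_one, mul_one] using
      hcont.continuousWithinAt.tendsto_nhdsWithin (x := 1) fun y hy => by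
        simpa only [mem_compl_iff, mem_singleton_iff, Complex.ofReal_one, mul_one] using hinj.ne hy
  refine hlim.frequently (Filter.Eventually.frequently ?_)
  filter_upwards [nhdsWithin_le_nhds (Ioi_mem_nhds one_pos)] with y hy using hgh y hy

theorem norm_exp_two_pi_I_mul_le_one {w : ℂ} (hw : 0 ≤ w.im) (n : ℕ) :
    ‖Complex.exp (2 * π * Complex.I * n * w)‖ ≤ 1 := by
  rw [Complex.norm_exp, Real.exp_le_one_iff]
  have hre : (2 * π * Complex.I * n * w).re = -(2 * π * n * w.im) := by simp
  rw [hre, neg_nonpos]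
  positivity

variable {m : ℕ} (f : CuspForm 𝒮ℒ ((2 * m + 2 : ℕ) : ℤ))

/-- The sum `∑ c(n) n⁻⁽²ᵐ⁺¹⁾ qⁿ`, which is the Eichler integral of `f` up to a constant factor. -/
noncomputable def eichlerSeries (w : ℂ) : ℂ :=
  ∑' n : ℕ, cuspCoeff f n / (n : ℂ) ^ (2 * m + 1) * Complex.exp (2 * π * Complex.I * n * w)

variable (m) in
/-- The constant `(2 m)! (i / (2 π)) ^ (2 m + 1)` by which the Eichler integral of a form of weight
`2 * m + 2` differs from its `eichlerSeries`. -/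
noncomputable def eichlerScale : ℂ := (2 * m).factorial * (Complex.I / (2 * π)) ^ (2 * m + 1)

theorem eichlerIntegral_eq_integral (z : ℍ) :
    eichlerIntegral f z = Complex.I ^ (2 * m + 1) *
      ∫ t in Ioi (0 : ℝ), (t : ℂ) ^ (2 * m) * f (ofComplex (z + Complex.I * t)) := by
  rw [eichlerIntegral, ← integral_const_mul]
  refine setIntegral_congr_fun measurableSet_Ioi fun t _ => ?_
  simp only [Nat.add_sub_cancel]
  ring

theorem norm_eichlerSeries_term_le {w : ℂ} (hw : 0 ≤ w.im) (n : ℕ) :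
    ‖cuspCoeff f n / (n : ℂ) ^ (2 * m + 1) * Complex.exp (2 * π * Complex.I * n * w)‖ ≤
      ‖cuspCoeff f n / (n : ℂ) ^ (2 * m + 1)‖ := by
  rw [norm_mul]
  exact mul_le_of_le_one_right (norm_nonneg _) (norm_exp_two_pi_I_mul_le_one hw n)

theorem summable_norm_cuspCoeff_div (hm : 2 ≤ m) :
    Summable fun n : ℕ => ‖cuspCoeff f n / (n : ℂ) ^ (2 * m + 1)‖ :=
  (hasSum_criticalValue f (by omega)).summable.norm

theorem eichlerIntegral_eq_eichlerSeries (hm : 2 ≤ m) (z : ℍ) :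
    eichlerIntegral f z = eichlerScale m * eichlerSeries f z := by
  have hre : (((2 * m : ℕ) : ℂ) + 1).re = (2 * m + 1 : ℕ) := by
    rw [← Nat.cast_succ, Complex.natCast_re]
  have h := hasSum_mellin (s := (2 * m : ℕ) + 1)
    (a := fun n => cuspCoeff f n * Complex.exp (2 * π * Complex.I * n * z))
    (p := fun n : ℕ => 2 * π * n) (F := fun t => f (ofComplex (z + Complex.I * t))) ?_ ?_
    (fun t ht => hasSum_cuspCoeff_mul_exp f z.im_pos.le ht) ?_
  · have hmellin : mellin (fun t => f (ofComplex (z + Complex.I * t))) ((2 * m : ℕ) + 1) =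
        ∫ t in Ioi (0 : ℝ), (t : ℂ) ^ (2 * m) * f (ofComplex (z + Complex.I * t)) := by
      simp only [mellin, add_sub_cancel_right, Complex.cpow_natCast, smul_eq_mul]
    rw [eichlerIntegral_eq_integral, ← hmellin, ← h.tsum_eq, eichlerSeries, ← tsum_mul_left,
      ← tsum_mul_left]
    refine tsum_congr fun n => ?_
    rw [Complex.Gamma_nat_eq_factorial, ← Nat.cast_add_one, Complex.cpow_natCast, eichlerScale,
      div_pow]
    push_cast
    rw [mul_pow _ (n : ℂ)]
    ring
  · intro n
    rcases Nat.eq_zero_or_pos n with rfl | hn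
    · exact Or.inl (by rw [cuspCoeff_zero, zero_mul])
    · exact Or.inr (by positivity)
  · rw [hre]
    positivity
  · have hsum := (summable_norm_cuspCoeff_div f hm).of_nonneg_of_le (fun _ => norm_nonneg _)
      (norm_eichlerSeries_term_le f z.im_pos.le)
    refine (hsum.div_const ((2 * π) ^ (2 * m + 1))).congr fun n => ?_
    rw [hre, Real.rpow_natCast, mul_pow, norm_mul, norm_mul, norm_div, norm_pow,
      Complex.norm_natCast]
    ring

theorem differentiableOn_eichlerSeries (hm : 2 ≤ m) :
    DifferentiableOn ℂ (eichlerSeries f) {w | 0 < w.im} :=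
  Complex.differentiableOn_tsum_of_summable_norm (summable_norm_cuspCoeff_div f hm)
    (fun n => by fun_prop) isOpen_upperHalfPlaneSet
    fun n _ hw => norm_eichlerSeries_term_le f (le_of_lt hw) n

theorem integral_sub_pow_mul_onImag (y : ℂ) :
    IntegrableOn (fun t : ℝ => (t - y) ^ (2 * m) * onImag f t) (Ioi 0) ∧
      ∫ t in Ioi (0 : ℝ), (t - y) ^ (2 * m) * onImag f t = ∑ j ∈ Finset.range (2 * m + 1),
        (2 * m).choose j * moment f (2 * m - j) * (-y) ^ j := by
  have hexpand (t : ℝ) : (t - y) ^ (2 * m) * onImag f t = ∑ j ∈ Finset.range (2 * m + 1),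
      ((2 * m).choose j * (-y) ^ j) * ((t : ℂ) ^ (2 * m - j) * onImag f t) := by
    rw [sub_eq_neg_add, add_pow, Finset.sum_mul]
    exact Finset.sum_congr rfl fun j _ => by ring
  have hint (j : ℕ) := (integrableOn_pow_mul_onImag f (2 * m - j)).const_mul
    ((2 * m).choose j * (-y) ^ j)
  simp only [hexpand]
  refine ⟨integrable_finsetSum _ fun j _ => hint j, ?_⟩
  rw [integral_finsetSum _ fun j _ => hint j]
  refine Finset.sum_congr rfl fun j _ => ?_
  rw [integral_const_mul, moment]
  ring

theorem choose_mul_moment_eq {j : ℕ} (hj : j ≤ 2 * m) :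
    Complex.I ^ (2 * m + 1) * ((2 * m).choose j * moment f (2 * m - j)) =
      eichlerScale m * periodCoeff f j := by
  rw [periodCoeff_eq f hj, eichlerScale, Nat.cast_choose ℂ hj, div_pow]
  field_simp

theorem eichlerIntegral_on_imag {y : ℝ} {z : ℍ} (hz : (z : ℂ) = Complex.I * y) :
    eichlerIntegral f z = Complex.I ^ (2 * m + 1) *
      ∫ t in Ioi y, ((t : ℂ) - y) ^ (2 * m) * onImag f t := by
  rw [eichlerIntegral_eq_integral]
  have h := integral_Ioi_comp_add_right (fun t => ((t : ℂ) - y) ^ (2 * m) * onImag f t) 0 y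
  rw [zero_add] at h
  rw [← h]
  congr 1
  refine setIntegral_congr_fun measurableSet_Ioi fun t _ => ?_
  simp only [onImag, hz]
  push_cast
  rw [add_sub_cancel_right, mul_add, add_comm (Complex.I * (t : ℂ))]

theorem integral_Ioi_inv_eq_neg_integral_Ioo {y : ℝ} (hy : 0 < y) :
    (Complex.I * y) ^ (2 * m) * ∫ t in Ioi y⁻¹, ((t : ℂ) - (y⁻¹ : ℝ)) ^ (2 * m) * onImag f t =
      -∫ t in Ioo 0 y, ((t : ℂ) - y) ^ (2 * m) * onImag f t := by
  rw [← inv_Ioo_0_left hy, setIntegral_inv_eq measurableSet_Ioo Ioo_subset_Ioi_self,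
    ← integral_const_mul, ← integral_neg]
  refine setIntegral_congr_fun measurableSet_Ioo fun t ht => ?_
  have ht0 : (t : ℂ) ≠ 0 := mod_cast ht.1.ne'
  have hy0 : (y : ℂ) ≠ 0 := mod_cast hy.ne'
  have hI : Complex.I ^ (2 * m) * Complex.I ^ (2 * m) = 1 := by
    rw [← mul_pow, Complex.I_mul_I, pow_mul, neg_one_sq, one_pow]
  have hsub : ((t⁻¹ : ℝ) : ℂ) - (y⁻¹ : ℝ) = -((t - y) / (t * y)) := by
    push_cast
    field_simp
    ring
  simp only [onImag_inv f ht.1, Complex.real_smul]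
  rw [hsub, (even_two_mul m).neg_pow, div_pow, mul_pow, mul_pow, pow_add Complex.I,
    pow_add (t : ℂ), Complex.I_sq]
  push_cast
  field_simp
  linear_combination (-(t - y : ℂ) ^ (2 * m) * onImag f t) * hI

theorem eichlerIntegral_sub_on_imag {y : ℝ} (hy : 0 < y) {z : ℍ} (hz : (z : ℂ) = Complex.I * y) :
    eichlerIntegral f z - (z : ℂ) ^ (2 * m) * eichlerIntegral f (ModularGroup.S • z) =
      eichlerScale m * ∑ j ∈ Finset.range (2 * m + 1), periodCoeff f j * (Complex.I * z) ^ j := by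
  have hSz : ((ModularGroup.S • z : ℍ) : ℂ) = Complex.I * (y⁻¹ : ℝ) := by
    rw [modular_S_smul]
    change (-(z : ℂ))⁻¹ = _
    rw [hz, inv_neg, mul_inv, Complex.inv_I, neg_mul, neg_neg, Complex.ofReal_inv]
  have hIz : Complex.I * z = -(y : ℂ) := by
    rw [hz, ← mul_assoc, Complex.I_mul_I, neg_one_mul]
  obtain ⟨hint, hsum⟩ := integral_sub_pow_mul_onImag f y
  have hsplit : ∫ t in Ioi (0 : ℝ), ((t : ℂ) - y) ^ (2 * m) * onImag f t =
      (∫ t in Ioo 0 y, ((t : ℂ) - y) ^ (2 * m) * onImag f t) +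
        ∫ t in Ioi y, ((t : ℂ) - y) ^ (2 * m) * onImag f t := by
    rw [← integral_Ioc_eq_integral_Ioo, ← Ioc_union_Ioi_eq_Ioi hy.le,
      setIntegral_union (Ioc_disjoint_Ioi le_rfl) measurableSet_Ioi
        (hint.mono_set Ioc_subset_Ioi_self) (hint.mono_set (Ioi_subset_Ioi hy.le))]
  calc _ = Complex.I ^ (2 * m + 1) *
        ∫ t in Ioi (0 : ℝ), ((t : ℂ) - y) ^ (2 * m) * onImag f t := by
        rw [eichlerIntegral_on_imag f hz, eichlerIntegral_on_imag f hSz, hz, mul_left_comm,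
          integral_Ioi_inv_eq_neg_integral_Ioo f hy, hsplit]
        ring
    _ = _ := by
        rw [hsum, hIz, Finset.mul_sum, Finset.mul_sum]
        refine Finset.sum_congr rfl fun j hj => ?_
        rw [← mul_assoc, choose_mul_moment_eq f (Nat.lt_succ_iff.1 (Finset.mem_range.1 hj)),
          mul_assoc]

/-- The period polynomial of `f`, written in terms of its critical `L`-values. -/
noncomputable def periodPolynomial : ℂ[X] :=
  C (eichlerScale m) *
    ∑ j ∈ Finset.range (2 * m + 1), C (periodCoeff f j * Complex.I ^ j) * X ^ j

theorem eval_periodPolynomial (z : ℂ) : (periodPolynomial f).eval z =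
    eichlerScale m * ∑ j ∈ Finset.range (2 * m + 1), periodCoeff f j * (Complex.I * z) ^ j := by
  simp only [periodPolynomial, eval_mul, eval_C, eval_finsetSum, eval_pow, eval_X, mul_pow,
    mul_assoc]

theorem natDegree_periodPolynomial_le : (periodPolynomial f).natDegree ≤ 2 * m :=
  (natDegree_C_mul_le _ _).trans <| natDegree_sum_le_of_forall_le _ _ fun _ hj =>
    (natDegree_C_mul_X_pow_le _ _).trans (Nat.lt_succ_iff.1 (Finset.mem_range.1 hj))

theorem isPeriodPolynomial_periodPolynomial (hm : 2 ≤ m) :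
    IsPeriodPolynomial f (periodPolynomial f) := by
  have hseries (z : ℍ) :
      eichlerIntegral f z - (z : ℂ) ^ (2 * m) * eichlerIntegral f (ModularGroup.S • z) =
        eichlerScale m * (eichlerSeries f z - (z : ℂ) ^ (2 * m) * eichlerSeries f (-z)⁻¹) := by
    rw [eichlerIntegral_eq_eichlerSeries f hm, eichlerIntegral_eq_eichlerSeries f hm,
      modular_S_smul]
    ring
  have hd := differentiableOn_eichlerSeries f hm
  have hne {w : ℂ} (hw : 0 < w.im) : -w ≠ 0 := fun h => by simp [neg_eq_zero.1 h] at hw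
  have hmaps : MapsTo (fun w : ℂ => (-w)⁻¹) {w | 0 < w.im} {w | 0 < w.im} :=
    fun w hw => (⟨w, hw⟩ : ℍ).im_inv_neg_coe_pos
  have hcomp := hd.comp ((differentiable_neg.differentiableOn).inv fun w hw => hne hw) hmaps
  refine ⟨natDegree_periodPolynomial_le f, fun z => ?_⟩
  rw [Nat.add_sub_cancel, hseries]
  refine eqOn_upperHalfPlane_of_eqOn_imag (periodPolynomial f).differentiable.differentiableOn
    ((hd.sub ((differentiable_pow (2 * m)).differentiableOn.mul hcomp)).const_mul _)
    (fun y hy => ?_) z.im_pos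
  have him : 0 < (Complex.I * y).im := by simpa using hy
  rw [eval_periodPolynomial]
  exact (eichlerIntegral_sub_on_imag f hy (z := ⟨_, him⟩) rfl).symm.trans (hseries ⟨_, him⟩)

end Eichler

section Estimates

open MeasureTheory Set
open scoped Real

theorem central_factor_le {x : ℝ} (hx : 0 < x) {m : ℕ} (hm : 6 ≤ m) :
    x ^ (m - 1) / (m - 1).factorial * (2 * (m + 2) / x) +
      x ^ m / m.factorial * ((m + 1) * (m + 2) / x ^ 2) ≤
        6 * (x ^ (m - 2) / (m - 2).factorial) := by
  obtain ⟨l, rfl⟩ : ∃ l, m = l + 2 := ⟨m - 2, by omega⟩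
  have hl : (4 : ℝ) ≤ l := mod_cast (by omega : 4 ≤ l)
  rw [show l + 2 - 1 = l + 1 by omega, Nat.add_sub_cancel]
  have hpred : x ^ (l + 1) / (l + 1).factorial * (2 * ((l + 2 : ℕ) + 2) / x) =
      2 * (l + 4) / (l + 1) * (x ^ l / l.factorial) := by
    rw [Nat.factorial_succ, pow_succ]; push_cast; field_simp; ring
  have hmid : x ^ (l + 2) / (l + 2).factorial * (((l + 2 : ℕ) + 1) * ((l + 2 : ℕ) + 2) / x ^ 2) =
      (l + 3) * (l + 4) / ((l + 1) * (l + 2)) * (x ^ l / l.factorial) := by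
    rw [Nat.factorial_succ, Nat.factorial_succ]; push_cast; field_simp; ring
  have hpred_le : 2 * ((l : ℝ) + 4) / (l + 1) ≤ 4 := by
    rw [div_le_iff₀ (by positivity)]; linarith
  have hmid_le : ((l : ℝ) + 3) * (l + 4) / ((l + 1) * (l + 2)) ≤ 2 := by
    rw [div_le_iff₀ (by positivity)]; nlinarith
  rw [hpred, hmid, ← add_mul]
  gcongr
  linarith

theorem norm_halfSum_sub_le (b μ : ℕ → ℂ) {J m : ℕ} (hJ : J ≤ m) {x : ℂ} (hx : ‖x‖ ≤ 1) :
    ‖halfSum m b x - ∑ j ∈ Finset.range (m + 1), μ j * x ^ j‖ ≤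
      ∑ j ∈ Finset.range J, ‖b j - μ j‖ + (∑ j ∈ Finset.Ico J m, ‖b j‖ + ‖b m‖ / 2) +
        ∑ j ∈ Finset.Ico J (m + 1), ‖μ j‖ := by
  have hterm (c : ℂ) (j : ℕ) : ‖c * x ^ j‖ ≤ ‖c‖ := by
    rw [norm_mul, norm_pow]
    exact mul_le_of_le_one_right (norm_nonneg _) (pow_le_one₀ (norm_nonneg _) hx)
  have hsum (s : Finset ℕ) (c : ℕ → ℂ) : ‖∑ j ∈ s, c j * x ^ j‖ ≤ ∑ j ∈ s, ‖c j‖ :=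
    norm_sum_le_of_le _ fun _ _ => hterm _ _
  have hhalf : ‖b m / 2 * x ^ m‖ ≤ ‖b m‖ / 2 :=
    (hterm _ _).trans_eq (by rw [norm_div, Complex.norm_ofNat])
  have hsplit : halfSum m b x - ∑ j ∈ Finset.range (m + 1), μ j * x ^ j =
      ∑ j ∈ Finset.range J, (b j - μ j) * x ^ j +
        (∑ j ∈ Finset.Ico J m, b j * x ^ j + b m / 2 * x ^ m) -
          ∑ j ∈ Finset.Ico J (m + 1), μ j * x ^ j := by
    rw [halfSum, ← Finset.sum_range_add_sum_Ico _ hJ,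
      ← Finset.sum_range_add_sum_Ico _ (show J ≤ m + 1 by omega)]
    simp only [sub_mul, Finset.sum_sub_distrib]
    ring
  rw [hsplit]
  exact norm_sub_le_of_le
    (norm_add_le_of_le (hsum _ _) (norm_add_le_of_le (hsum _ _) hhalf)) (hsum _ _)

variable {m : ℕ} {f : CuspForm 𝒮ℒ ((2 * m + 2 : ℕ) : ℤ)} {D : ℝ} {N : ℕ}

theorem nonneg_of_norm_cuspCoeff_le (hc : ∀ n, ‖cuspCoeff f n‖ ≤ D * (n : ℝ) ^ (m + 1)) :
    0 ≤ D := by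
  simpa only [Nat.cast_one, one_pow, mul_one] using (norm_nonneg _).trans (hc 1)

theorem norm_cuspCoeff_div_le (hc : ∀ n, ‖cuspCoeff f n‖ ≤ D * (n : ℝ) ^ (m + 1)) {n p : ℕ}
    (hn : n ≠ 0) (hp : m ≤ p) :
    ‖cuspCoeff f n / (n : ℂ) ^ (p + 1)‖ ≤ D / (n : ℝ) ^ (p - m) := by
  rw [norm_div, norm_pow, Complex.norm_natCast, div_le_div_iff₀ (by positivity) (by positivity),
    show p + 1 = m + 1 + (p - m) by omega, pow_add, ← mul_assoc]
  gcongr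
  exact hc n

theorem tsum_norm_cuspCoeff_div_le (hc : ∀ n, ‖cuspCoeff f n‖ ≤ D * (n : ℝ) ^ (m + 1)) {p : ℕ}
    (hp : m + 2 ≤ p) : ∑' n : ℕ, ‖cuspCoeff f n / (n : ℂ) ^ (p + 1)‖ ≤ 2 * D := by
  have h := norm_le_of_hasSum_of_norm_le_div_pow (hasSum_criticalValue f hp).summable.norm.hasSum
    (B := D) (M := 1) (q := p - m - 1) one_ne_zero (by omega) (fun n hn => ?_) (fun n hn => ?_)
  · rw [Nat.cast_one, one_pow, div_one] at h
    exact (Real.le_norm_self _).trans h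
  · rw [Nat.lt_one_iff.1 hn, cuspCoeff_zero, zero_div, norm_zero]
  · rw [norm_norm, show p - m - 1 + 1 = p - m by omega]
    exact norm_cuspCoeff_div_le hc (by omega) (by omega)

theorem norm_criticalValue_le (hc : ∀ n, ‖cuspCoeff f n‖ ≤ D * (n : ℝ) ^ (m + 1)) {p : ℕ}
    (hp : m + 2 ≤ p) : ‖criticalValue f p‖ ≤ 2 * D := by
  have h := hasSum_criticalValue f hp
  rw [← h.tsum_eq]
  exact (norm_tsum_le_tsum_norm h.summable.norm).trans (tsum_norm_cuspCoeff_div_le hc hp)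

theorem norm_criticalValue_sub_le (hc : ∀ n, ‖cuspCoeff f n‖ ≤ D * (n : ℝ) ^ (m + 1))
    (hvanish : ∀ n < N, cuspCoeff f n = 0) {p : ℕ} (hp : N + m + 2 ≤ p) :
    ‖criticalValue f p - cuspCoeff f N / (N : ℂ) ^ (p + 1)‖ ≤ 2 * D / ((N : ℝ) + 1) ^ (p - m) := by
  have hsum := (hasSum_criticalValue f (show m + 2 ≤ p by omega)).sub
    (hasSum_ite_eq N (cuspCoeff f N / (N : ℂ) ^ (p + 1)))
  have h := norm_le_of_hasSum_of_norm_le_div_pow hsum (B := D) (M := N + 1) (q := p - m - 1)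
    N.succ_ne_zero (by omega) (fun n hn => ?_) (fun n hn => ?_)
  · rwa [Nat.cast_add_one, show p - m - 1 + 1 = p - m by omega] at h
  · rcases Nat.lt_succ_iff_lt_or_eq.1 hn with hn | rfl
    · rw [hvanish n hn, if_neg hn.ne, zero_div, sub_zero]
    · rw [if_pos rfl, sub_self]
  · rw [if_neg (by omega), sub_zero, show p - m - 1 + 1 = p - m by omega]
    exact norm_cuspCoeff_div_le hc (by omega) (by omega)

theorem integral_pow_mul_norm_onImag_le (hc : ∀ n, ‖cuspCoeff f n‖ ≤ D * (n : ℝ) ^ (m + 1))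
    {p : ℕ} (hp : m + 2 ≤ p) :
    ∫ t in Ioi (0 : ℝ), t ^ p * ‖onImag f t‖ ≤ p.factorial / (2 * π) ^ (p + 1) * (2 * D) := by
  let F (n : ℕ) (t : ℝ) : ℂ :=
    cuspCoeff f n * ((t ^ p * Real.exp (-(2 * π * n) * t) : ℝ) : ℂ)
  have hF (n : ℕ) : IntegrableOn (F n) (Ioi 0) := by
    rcases eq_or_ne n 0 with rfl | hn
    · simp only [F, cuspCoeff_zero, zero_mul, integrableOn_zero]
    · exact (integrableOn_pow_mul_exp_neg_mul p (by positivity)).ofReal.const_mul _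
  have hint (n : ℕ) : ∫ t in Ioi (0 : ℝ), ‖F n t‖ =
      p.factorial / (2 * π) ^ (p + 1) * ‖cuspCoeff f n / (n : ℂ) ^ (p + 1)‖ := by
    rcases eq_or_ne n 0 with rfl | hn
    · simp only [F, cuspCoeff_zero, zero_mul, zero_div, norm_zero, mul_zero, integral_zero]
    · have hnorm : EqOn (fun t => ‖F n t‖)
          (fun t => ‖cuspCoeff f n‖ * (t ^ p * Real.exp (-(2 * π * n) * t))) (Ioi 0) :=
        fun t (ht : 0 < t) => by
          simp only [F, norm_mul, norm_pow, Complex.norm_real, Real.norm_of_nonneg ht.le,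
            Real.norm_of_nonneg (Real.exp_nonneg _)]
      rw [setIntegral_congr_fun measurableSet_Ioi hnorm, integral_const_mul,
        integral_pow_mul_exp_neg_mul p (by positivity), norm_div, norm_pow, Complex.norm_natCast,
        mul_pow]
      ring
  have hsummable := (hasSum_criticalValue f hp).summable.norm.mul_left
    (p.factorial / (2 * π) ^ (p + 1))
  calc ∫ t in Ioi (0 : ℝ), t ^ p * ‖onImag f t‖
      = ∫ t in Ioi (0 : ℝ), ‖(t : ℂ) ^ p * onImag f t‖ :=
        setIntegral_congr_fun measurableSet_Ioi fun t (ht : 0 < t) => by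
          rw [norm_mul, norm_pow, Complex.norm_real, Real.norm_of_nonneg ht.le]
    _ ≤ ∑' n, ∫ t in Ioi (0 : ℝ), ‖F n t‖ := by
        refine integral_norm_le_tsum_integral_norm hF (by simpa only [hint] using hsummable)
          (ae_restrict_of_forall_mem measurableSet_Ioi fun t ht => ?_)
        refine ((hasSum_onImag f ht).mul_left ((t : ℂ) ^ p)).congr_fun fun n => ?_
        push_cast [F]
        ring
    _ ≤ _ := by
        simp only [hint, tsum_mul_left]
        gcongr
        exact tsum_norm_cuspCoeff_div_le hc hp

theorem integrableOn_pow_mul_norm_onImag (f : CuspForm 𝒮ℒ ((2 * m + 2 : ℕ) : ℤ)) (p : ℕ) :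
    IntegrableOn (fun t : ℝ => t ^ p * ‖onImag f t‖) (Ioi 0) :=
  IntegrableOn.congr_fun (integrableOn_pow_mul_onImag f p).norm (fun t (ht : 0 < t) => by
    simp only [norm_mul, norm_pow, Complex.norm_real, Real.norm_of_nonneg ht.le]) measurableSet_Ioi

/- The Dirichlet series may diverge at the central values, but `t ^ r ≤ t ^ p + t ^ q` and the
functional equation identifies the two resulting moments, one of which lies where it converges. -/
theorem norm_moment_le {p q r : ℕ} (hpq : p + q = 2 * m) (hqr : q ≤ r) (hrp : r ≤ p) :
    ‖moment f r‖ ≤ 2 * ∫ t in Ioi (0 : ℝ), t ^ p * ‖onImag f t‖ := by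
  have hp := integrableOn_pow_mul_norm_onImag f p
  have hq := integrableOn_pow_mul_norm_onImag f q
  calc ‖moment f r‖ ≤ ∫ t in Ioi (0 : ℝ), ‖(t : ℂ) ^ r * onImag f t‖ :=
        norm_integral_le_integral_norm _
    _ ≤ ∫ t in Ioi (0 : ℝ), (t ^ p * ‖onImag f t‖ + t ^ q * ‖onImag f t‖) := by
        refine setIntegral_mono_on (integrableOn_pow_mul_onImag f r).norm (hp.add hq)
          measurableSet_Ioi fun t (ht : 0 < t) => ?_
        rw [norm_mul, norm_pow, Complex.norm_real, Real.norm_of_nonneg ht.le, ← add_mul]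
        gcongr
        rcases le_total 1 t with h | h
        · exact (pow_le_pow_right₀ h hrp).trans (le_add_of_nonneg_right (by positivity))
        · exact (pow_le_pow_of_le_one ht.le h hqr).trans (le_add_of_nonneg_left (by positivity))
    _ = 2 * ∫ t in Ioi (0 : ℝ), t ^ p * ‖onImag f t‖ := by
        rw [integral_add hp hq, integral_pow_mul_norm_onImag_symm f hpq]
        ring

theorem norm_criticalValue_central_le (hc : ∀ n, ‖cuspCoeff f n‖ ≤ D * (n : ℝ) ^ (m + 1))
    {r : ℕ} (hr : m ≤ r + 2) (hr' : r ≤ m + 2) (hm : 2 ≤ m) :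
    ‖criticalValue f r‖ ≤
      (2 * π) ^ (r + 1) / r.factorial * (4 * D * ((m + 2).factorial / (2 * π) ^ (m + 3))) := by
  have hmoment := norm_moment_le (f := f) (show m + 2 + (m - 2) = 2 * m by omega)
    (show m - 2 ≤ r by omega) hr'
  rw [criticalValue_eq, norm_mul, norm_div, norm_pow, norm_mul, Complex.norm_ofNat,
    Complex.norm_natCast, Complex.norm_real, Real.norm_of_nonneg Real.pi_pos.le]
  gcongr
  linarith [integral_pow_mul_norm_onImag_le hc (le_refl (m + 2))]

theorem norm_periodCoeff (f : CuspForm 𝒮ℒ ((2 * m + 2 : ℕ) : ℤ)) (j : ℕ) :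
    ‖periodCoeff f j‖ = (2 * π) ^ j / j.factorial * ‖criticalValue f (2 * m - j)‖ := by
  rw [periodCoeff, norm_mul, norm_div, norm_pow, norm_mul, Complex.norm_ofNat,
    Complex.norm_natCast, Complex.norm_real, Real.norm_of_nonneg Real.pi_pos.le]

theorem norm_periodCoeff_central_le (hc : ∀ n, ‖cuspCoeff f n‖ ≤ D * (n : ℝ) ^ (m + 1))
    (hm : 6 ≤ m) :
    ‖periodCoeff f (m - 1)‖ + ‖periodCoeff f m‖ / 2 ≤
      12 * D * ((2 * π) ^ (m - 2) / (m - 2).factorial) := by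
  have hpred : ‖criticalValue f (m + 1)‖ ≤ 2 * D * (2 * (m + 2) / (2 * π)) := by
    refine (norm_criticalValue_central_le hc (by omega) (by omega) (by omega)).trans_eq ?_
    rw [Nat.factorial_succ (m + 1), pow_succ _ (m + 2)]
    push_cast
    field_simp
    ring
  have hmid : ‖criticalValue f m‖ ≤ 4 * D * ((m + 1) * (m + 2) / (2 * π) ^ 2) := by
    refine (norm_criticalValue_central_le hc (by omega) (by omega) (by omega)).trans_eq ?_
    rw [Nat.factorial_succ (m + 1), Nat.factorial_succ m, show m + 3 = m + 1 + 2 by omega,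
      pow_add _ (m + 1)]
    push_cast
    field_simp
    ring
  rw [norm_periodCoeff, norm_periodCoeff, show 2 * m - (m - 1) = m + 1 by omega,
    show 2 * m - m = m by omega]
  calc _ ≤ (2 * π) ^ (m - 1) / (m - 1).factorial * (2 * D * (2 * (m + 2) / (2 * π))) +
        (2 * π) ^ m / m.factorial * (4 * D * ((m + 1) * (m + 2) / (2 * π) ^ 2)) / 2 := by gcongr
    _ = 2 * D * ((2 * π) ^ (m - 1) / (m - 1).factorial * (2 * (m + 2) / (2 * π)) +
        (2 * π) ^ m / m.factorial * ((m + 1) * (m + 2) / (2 * π) ^ 2)) := by ring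
    _ ≤ 2 * D * (6 * ((2 * π) ^ (m - 2) / (m - 2).factorial)) := by
        have hD := nonneg_of_norm_cuspCoeff_le hc
        gcongr
        exact central_factor_le Real.two_pi_pos hm
    _ = 12 * D * ((2 * π) ^ (m - 2) / (m - 2).factorial) := by ring

theorem sum_Ico_norm_periodCoeff_le (hc : ∀ n, ‖cuspCoeff f n‖ ≤ D * (n : ℝ) ^ (m + 1))
    (hm : 6 ≤ m) {J : ℕ} (hJ : J + 2 ≤ m) :
    ∑ j ∈ Finset.Ico J m, ‖periodCoeff f j‖ + ‖periodCoeff f m‖ / 2 ≤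
      14 * D * ((2 * π) ^ J / J.factorial * Real.exp (2 * π)) := by
  have hD := nonneg_of_norm_cuspCoeff_le hc
  have hlow : ∑ j ∈ Finset.Ico J (m - 1), ‖periodCoeff f j‖ ≤
      2 * D * ∑ j ∈ Finset.Ico J (m - 1), (2 * π) ^ j / j.factorial := by
    rw [Finset.mul_sum]
    refine Finset.sum_le_sum fun j hj => ?_
    have hj := Finset.mem_Ico.1 hj
    rw [norm_periodCoeff, mul_comm]
    gcongr
    exact norm_criticalValue_le hc (by omega)
  have hsingle : (2 * π) ^ (m - 2) / (m - 2).factorial ≤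
      ∑ j ∈ Finset.Ico J (m - 1), (2 * π) ^ j / j.factorial :=
    Finset.single_le_sum (f := fun j => (2 * π) ^ j / (j.factorial : ℝ))
      (fun j _ => by positivity) (Finset.mem_Ico.2 ⟨by omega, by omega⟩)
  calc _ = ∑ j ∈ Finset.Ico J (m - 1), ‖periodCoeff f j‖ +
        (‖periodCoeff f (m - 1)‖ + ‖periodCoeff f m‖ / 2) := by
        obtain ⟨l, rfl⟩ : ∃ l, m = l + 1 := ⟨m - 1, by omega⟩
        rw [Finset.sum_Ico_succ_top (by omega), Nat.add_sub_cancel, add_assoc]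
    _ ≤ 2 * D * ∑ j ∈ Finset.Ico J (m - 1), (2 * π) ^ j / j.factorial +
        12 * D * ∑ j ∈ Finset.Ico J (m - 1), (2 * π) ^ j / j.factorial := by
        refine add_le_add hlow ((norm_periodCoeff_central_le hc hm).trans ?_)
        gcongr
    _ = 14 * D * ∑ j ∈ Finset.Ico J (m - 1), (2 * π) ^ j / j.factorial := by ring
    _ ≤ _ := by gcongr; exact sum_Ico_pow_div_factorial_le Real.two_pi_pos.le J (m - 1)

theorem norm_periodCoeff_sub_le (hc : ∀ n, ‖cuspCoeff f n‖ ≤ D * (n : ℝ) ^ (m + 1))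
    (hvanish : ∀ n < N, cuspCoeff f n = 0) (hnorm : cuspCoeff f N = 1) {j : ℕ}
    (hj : N + j + 2 ≤ m) :
    ‖periodCoeff f j - (2 * π * N) ^ j / j.factorial / (N : ℂ) ^ (2 * m + 1)‖ ≤
      (2 * π) ^ j / j.factorial * (2 * D / ((N : ℝ) + 1) ^ (m - j)) := by
  have hN : (N : ℂ) ≠ 0 := mod_cast ne_zero_of_cuspCoeff_eq_one hnorm
  have h := norm_criticalValue_sub_le hc hvanish (show N + m + 2 ≤ 2 * m - j by omega)
  rw [hnorm, show 2 * m - j - m = m - j by omega] at h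
  have hfactor : periodCoeff f j - (2 * π * N) ^ j / j.factorial / (N : ℂ) ^ (2 * m + 1) =
      (2 * π) ^ j / j.factorial *
        (criticalValue f (2 * m - j) - 1 / (N : ℂ) ^ (2 * m - j + 1)) := by
    rw [periodCoeff, show 2 * m + 1 = 2 * m - j + 1 + j by omega, pow_add _ _ j,
      mul_pow _ (N : ℂ)]
    field_simp
  rw [hfactor, norm_mul, norm_div, norm_pow, norm_mul, Complex.norm_ofNat,
    Complex.norm_natCast, Complex.norm_real, Real.norm_of_nonneg Real.pi_pos.le]
  gcongr

theorem sum_range_norm_periodCoeff_sub_le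
    (hc : ∀ n, ‖cuspCoeff f n‖ ≤ D * (n : ℝ) ^ (m + 1))
    (hvanish : ∀ n < N, cuspCoeff f n = 0) (hnorm : cuspCoeff f N = 1) {J : ℕ}
    (hJ : N + J < m) :
    ∑ j ∈ Finset.range J,
        ‖periodCoeff f j - (2 * π * N) ^ j / j.factorial / (N : ℂ) ^ (2 * m + 1)‖ ≤
      2 * D / ((N : ℝ) + 1) ^ (m + 1 - J) * Real.exp (2 * π) := by
  have hD := nonneg_of_norm_cuspCoeff_le hc
  calc _ ≤ ∑ j ∈ Finset.range J,
        2 * D / ((N : ℝ) + 1) ^ (m + 1 - J) * ((2 * π) ^ j / j.factorial) := by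
        refine Finset.sum_le_sum fun j hj => ?_
        have hj := Finset.mem_range.1 hj
        refine (norm_periodCoeff_sub_le hc hvanish hnorm (by omega)).trans ?_
        have hexponent : m + 1 - J ≤ m - j := by omega
        rw [mul_comm]
        gcongr
        exact le_add_of_nonneg_left (Nat.cast_nonneg N)
    _ ≤ _ := by
        rw [← Finset.mul_sum]
        gcongr
        exact Real.sum_le_exp_of_nonneg Real.two_pi_pos.le _

theorem halfSum_periodCoeff_ne_zero (hc : ∀ n, ‖cuspCoeff f n‖ ≤ D * (n : ℝ) ^ (m + 1))
    (hvanish : ∀ n < N, cuspCoeff f n = 0) (hnorm : cuspCoeff f N = 1) (hm : 6 ≤ m) {J : ℕ}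
    (hJ : N + J < m)
    (hbound : 2 * D / ((N : ℝ) + 1) ^ (m + 1 - J) * Real.exp (2 * π) +
        14 * D * ((2 * π) ^ J / J.factorial * Real.exp (2 * π)) +
        (2 * π * N) ^ J / J.factorial * Real.exp (2 * π * N) / (N : ℝ) ^ (2 * m + 1) <
      (Real.exp (-(2 * π * N)) - (2 * π * N) ^ (m + 1) / (m + 1).factorial *
        Real.exp (2 * π * N)) / (N : ℝ) ^ (2 * m + 1))
    {x : ℂ} (hx : ‖x‖ ≤ 1) : halfSum m (periodCoeff f) x ≠ 0 := by
  have hN := ne_zero_of_cuspCoeff_eq_one hnorm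
  have hnormN : ‖(2 * π * N : ℂ)‖ = 2 * π * N := by
    rw [norm_mul, norm_mul, Complex.norm_ofNat, Complex.norm_natCast, Complex.norm_real,
      Real.norm_of_nonneg Real.pi_pos.le]
  have hmain : (Real.exp (-(2 * π * N)) - (2 * π * N) ^ (m + 1) / (m + 1).factorial *
        Real.exp (2 * π * N)) / (N : ℝ) ^ (2 * m + 1) ≤
      ‖∑ j ∈ Finset.range (m + 1),
        (2 * π * N) ^ j / j.factorial / (N : ℂ) ^ (2 * m + 1) * x ^ j‖ := by
    have hw : ‖2 * π * N * x‖ ≤ 2 * π * N := by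
      rw [norm_mul, hnormN]
      exact mul_le_of_le_one_right (by positivity) hx
    have hsum : ∑ j ∈ Finset.range (m + 1),
        (2 * π * N) ^ j / j.factorial / (N : ℂ) ^ (2 * m + 1) * x ^ j =
        (∑ j ∈ Finset.range (m + 1), (2 * π * N * x) ^ j / j.factorial) / N ^ (2 * m + 1) := by
      rw [Finset.sum_div]
      exact Finset.sum_congr rfl fun j _ => by rw [mul_pow _ x]; ring
    rw [hsum, norm_div, norm_pow, Complex.norm_natCast]
    gcongr
    exact exp_neg_sub_le_norm_sum_range_pow_div_factorial hw (m + 1)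
  have htail : ∑ j ∈ Finset.Ico J (m + 1),
        ‖(2 * π * N) ^ j / j.factorial / (N : ℂ) ^ (2 * m + 1)‖ ≤
      (2 * π * N) ^ J / J.factorial * Real.exp (2 * π * N) / (N : ℝ) ^ (2 * m + 1) := by
    simp only [norm_div, norm_pow, Complex.norm_natCast, hnormN, ← Finset.sum_div]
    gcongr
    exact sum_Ico_pow_div_factorial_le (by positivity) J (m + 1)
  have herror := norm_halfSum_sub_le (periodCoeff f)
    (fun j => (2 * π * N) ^ j / j.factorial / (N : ℂ) ^ (2 * m + 1)) (show J ≤ m by omega) hx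
  intro hzero
  rw [hzero, zero_sub, norm_neg] at herror
  linarith [sum_range_norm_periodCoeff_sub_le hc hvanish hnorm hJ,
    sum_Ico_norm_periodCoeff_le hc hm (show J + 2 ≤ m by omega)]

end Estimates

section Conclusion

open scoped Real

theorem eichlerScale_ne_zero (m : ℕ) : eichlerScale m ≠ 0 :=
  mul_ne_zero (mod_cast (2 * m).factorial_ne_zero)
    (pow_ne_zero _ (div_ne_zero Complex.I_ne_zero (mod_cast Real.two_pi_pos.ne')))

theorem isUnimodular_periodPolynomial {m : ℕ} {f : CuspForm 𝒮ℒ ((2 * m + 2 : ℕ) : ℤ)}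
    (hreal : ∀ n, (cuspCoeff f n).im = 0) (hm : m ≠ 0)
    (hhalf : ∀ x : ℂ, ‖x‖ ≤ 1 → halfSum m (periodCoeff f) x ≠ 0) :
    IsUnimodular (periodPolynomial f) := by
  have hroot (z : ℂ) (hz : (periodPolynomial f).IsRoot z) : ‖z‖ = 1 := by
    rw [IsRoot, eval_periodPolynomial] at hz
    have hsum := (mul_eq_zero.1 hz).resolve_left (eichlerScale_ne_zero m)
    simpa only [norm_mul, Complex.norm_I, one_mul] using
      (isSelfInversive_periodCoeff f hreal).norm_eq_one_of_sum_eq_zero hm hhalf hsum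
  refine ⟨fun hzero => zero_ne_one (α := ℝ) ?_, hroot⟩
  rw [← hroot 0 (by rw [hzero, IsRoot, eval_zero]), norm_zero]

theorem six_mul_lt_of_pow_lt_factorial {N h : ℕ} (hlt : (2 * π * N) ^ h < h.factorial) :
    6 * N < h := by
  by_contra! hle
  have hfactorial : (h.factorial : ℝ) ≤ (h : ℝ) ^ h := mod_cast h.factorial_le_pow
  have hbase : (h : ℝ) ≤ 2 * π * N := calc
    (h : ℝ) ≤ 2 * 3 * N := by norm_num; exact_mod_cast hle
    _ ≤ 2 * π * N := by gcongr; exact Real.pi_gt_three.le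
  exact (hfactorial.trans (pow_le_pow_left₀ h.cast_nonneg hbase h)).not_gt hlt

theorem six_le_sqrt_mul_log {k : ℕ} (hk : 14 ≤ k) : 6 ≤ √k * Real.log (2 * k) := by
  have hk : (14 : ℝ) ≤ k := mod_cast hk
  have hsqrt : 3 ≤ √(k : ℝ) := Real.le_sqrt_of_sq_le (by linarith)
  have hlog : 2 ≤ Real.log (2 * k) := by
    have hexp : Real.exp 2 = Real.exp 1 ^ 2 := by rw [← Real.exp_nat_mul]; norm_num
    rw [Real.le_log_iff_exp_le (by positivity), hexp]
    nlinarith [Real.exp_one_lt_d9, Real.exp_one_gt_d9]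
  nlinarith

/-- The numerical hypothesis of the theorem: the errors made in replacing the first half of the
period polynomial by a truncated exponential (left side) are smaller than the minimum of that
truncated exponential on the unit disc (right side). -/
def KeyInequality (N k : ℕ) (C : ℝ) : Prop :=
  4 * Real.exp (2 * π) * C / ((N : ℝ) + 1) ^ ((k : ℝ) / 4)
      + 4 * Real.exp (2 * π) * C * (2 * π) ^ (k / 4) * (√k * Real.log (2 * k) + 1)
          / ((k / 4).factorial : ℝ)
      + Real.exp (2 * π * N) * (2 * π * N) ^ (k / 4)
          / ((N : ℝ) ^ (k - 1) * ((k / 4).factorial : ℝ))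
    < 1 / (N : ℝ) ^ (k - 1)
        * (Real.exp (-(2 * π * N))
            - (2 * π * N) ^ (k / 2) / ((k / 2).factorial : ℝ) * Real.exp (2 * π * N))

namespace KeyInequality

variable {N : ℕ} {C : ℝ}

theorem pow_lt_factorial {k : ℕ} (hkey : KeyInequality N k C) (hC : 0 ≤ C) :
    (2 * π * N) ^ (k / 2) < (k / 2).factorial := by
  have hlog : 0 ≤ Real.log (2 * k) := mod_cast Real.log_natCast_nonneg (2 * k)
  have hpos := pos_of_mul_pos_right (lt_of_le_of_lt (by positivity) hkey) (by positivity)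
  have hexp : 1 ≤ Real.exp (2 * π * N) := Real.one_le_exp (by positivity)
  have hexp_neg : Real.exp (-(2 * π * N)) ≤ 1 :=
    Real.exp_le_one_iff.2 (neg_nonpos.2 (by positivity))
  rw [← div_lt_one (by positivity)]
  calc (2 * π * N) ^ (k / 2) / ((k / 2).factorial : ℝ)
      ≤ (2 * π * N) ^ (k / 2) / ((k / 2).factorial : ℝ) * Real.exp (2 * π * N) :=
        le_mul_of_one_le_right (by positivity) hexp
    _ < Real.exp (-(2 * π * N)) := sub_pos.1 hpos
    _ ≤ 1 := hexp_neg

theorem error_lt {m : ℕ} (hkey : KeyInequality N (2 * m + 2) C) (hC : 0 ≤ C) (hm : 6 ≤ m) :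
    2 * (2 * C) / ((N : ℝ) + 1) ^ (m + 1 - (2 * m + 2) / 4) * Real.exp (2 * π) +
        14 * (2 * C) * ((2 * π) ^ ((2 * m + 2) / 4) / ((2 * m + 2) / 4).factorial *
          Real.exp (2 * π)) +
        (2 * π * N) ^ ((2 * m + 2) / 4) / ((2 * m + 2) / 4).factorial * Real.exp (2 * π * N) /
          (N : ℝ) ^ (2 * m + 1) <
      (Real.exp (-(2 * π * N)) - (2 * π * N) ^ (m + 1) / (m + 1).factorial *
        Real.exp (2 * π * N)) / (N : ℝ) ^ (2 * m + 1) := by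
  have hpow : ((N : ℝ) + 1) ^ (((2 * m + 2 : ℕ) : ℝ) / 4) ≤
      ((N : ℝ) + 1) ^ (m + 1 - (2 * m + 2) / 4) := by
    rw [← Real.rpow_natCast]
    refine Real.rpow_le_rpow_of_exponent_le (by linarith [N.cast_nonneg (α := ℝ)]) ?_
    rw [div_le_iff₀ (by norm_num)]
    exact_mod_cast (by omega : 2 * m + 2 ≤ (m + 1 - (2 * m + 2) / 4) * 4)
  rw [KeyInequality, show 2 * m + 2 - 1 = 2 * m + 1 by omega,
    show (2 * m + 2) / 2 = m + 1 by omega] at hkey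
  generalize (2 * m + 2) / 4 = J at hkey hpow ⊢
  have hnear : 2 * (2 * C) / ((N : ℝ) + 1) ^ (m + 1 - J) * Real.exp (2 * π) ≤
      4 * Real.exp (2 * π) * C / ((N : ℝ) + 1) ^ (((2 * m + 2 : ℕ) : ℝ) / 4) := calc
    _ = 4 * Real.exp (2 * π) * C / ((N : ℝ) + 1) ^ (m + 1 - J) := by ring
    _ ≤ _ := by gcongr
  have hcentral : 14 * (2 * C) * ((2 * π) ^ J / J.factorial * Real.exp (2 * π)) ≤
      4 * Real.exp (2 * π) * C * (2 * π) ^ J *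
        (√(2 * m + 2 : ℕ) * Real.log (2 * (2 * m + 2 : ℕ)) + 1) / J.factorial := calc
    _ = 4 * Real.exp (2 * π) * C * (2 * π) ^ J * (6 + 1) / J.factorial := by ring
    _ ≤ _ := by gcongr; exact six_le_sqrt_mul_log (by omega)
  calc _ ≤ _ := add_le_add (add_le_add hnear hcentral) (le_of_eq (by ring))
    _ < _ := hkey
    _ = _ := by ring

end KeyInequality

theorem sigma_zero_mul_rpow_le {k : ℕ} (hk : Even k) (n : ℕ) :
    (ArithmeticFunction.sigma 0 n : ℝ) * (n : ℝ) ^ (((k : ℝ) - 1) / 2) ≤ 2 * (n : ℝ) ^ (k / 2) := by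
  rcases Nat.eq_zero_or_pos n with rfl | hn
  · simp only [ArithmeticFunction.map_zero, Nat.cast_zero, zero_mul]
    positivity
  obtain ⟨h, rfl⟩ := even_iff_exists_two_mul.1 hk
  calc _ ≤ 2 * √n * (n : ℝ) ^ (((2 * h : ℕ) - 1 : ℝ) / 2) := by
        gcongr
        exact sigma_zero_le_two_mul_sqrt n
    _ = 2 * (n : ℝ) ^ h := by
        rw [Real.sqrt_eq_rpow, mul_assoc, ← Real.rpow_add (mod_cast hn), ← Real.rpow_natCast]
        congr 2
        push_cast
        ring
    _ = _ := by rw [Nat.mul_div_cancel_left _ two_pos]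

theorem norm_cuspCoeff_le_two_mul_pow {N k : ℕ} {f : CuspForm 𝒮ℒ (k : ℤ)} {C : ℝ}
    (hnorm : cuspCoeff f N = 1)
    (hC : ∀ n ≥ N, ‖cuspCoeff f n‖ ≤
      C * (ArithmeticFunction.sigma 0 n : ℝ) * (n : ℝ) ^ (((k : ℝ) - 1) / 2)) :
    ∀ n ≥ N, ‖cuspCoeff f n‖ ≤ 2 * C * (n : ℝ) ^ (k / 2) := by
  have heven := even_of_cuspCoeff_ne_zero f (hnorm ▸ one_ne_zero)
  have hC_nonneg : 0 ≤ C := by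
    have hone := hC N le_rfl
    rw [hnorm, norm_one, mul_assoc] at hone
    exact (pos_of_mul_pos_left (one_pos.trans_le hone) (by positivity)).le
  intro n hn
  calc ‖cuspCoeff f n‖ ≤ C * (ArithmeticFunction.sigma 0 n * (n : ℝ) ^ (((k : ℝ) - 1) / 2)) :=
        (hC n hn).trans_eq (mul_assoc _ _ _)
    _ ≤ C * (2 * (n : ℝ) ^ (k / 2)) :=
        mul_le_mul_of_nonneg_left (sigma_zero_mul_rpow_le heven n) hC_nonneg
    _ = 2 * C * (n : ℝ) ^ (k / 2) := by ring

end Conclusion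

theorem mainTheorem3_general {N k : ℕ} {f : CuspForm 𝒮ℒ (k : ℤ)}
    (hvanish : ∀ n < N, cuspCoeff f n = 0)
    (hnorm : cuspCoeff f N = 1)
    (hreal : ∀ n, (cuspCoeff f n).im = 0)
    {C : ℝ}
    (hC : ∀ n ≥ N, ‖cuspCoeff f n‖ ≤ 2 * C * (n : ℝ) ^ (k / 2))
    (hkey : KeyInequality N k C) :
    ∃ r : ℂ[X], IsPeriodPolynomial f r ∧ IsUnimodular r := by
  have hN := ne_zero_of_cuspCoeff_eq_one hnorm
  have hC_nonneg : 0 ≤ C := by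
    have hone := hC N le_rfl
    rw [hnorm, norm_one, mul_right_comm] at hone
    exact (pos_of_mul_pos_right (one_pos.trans_le hone) (by positivity)).le
  have hcoeff (n : ℕ) : ‖cuspCoeff f n‖ ≤ 2 * C * (n : ℝ) ^ (k / 2) := by
    rcases lt_or_ge n N with hn | hn
    · rw [hvanish n hn, norm_zero]
      positivity
    · exact hC n hn
  have hNk := six_mul_lt_of_pow_lt_factorial (hkey.pow_lt_factorial hC_nonneg)
  obtain ⟨m, rfl⟩ : ∃ m, k = 2 * m + 2 := by
    obtain ⟨h, rfl⟩ := even_of_cuspCoeff_ne_zero f (hnorm ▸ one_ne_zero)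
    exact ⟨h - 1, by omega⟩
  rw [show (2 * m + 2) / 2 = m + 1 by omega] at hcoeff hNk
  exact ⟨periodPolynomial f, isPeriodPolynomial_periodPolynomial f (by omega),
    isUnimodular_periodPolynomial hreal (by omega) fun x hx =>
      halfSum_periodCoeff_ne_zero hcoeff hvanish hnorm (by omega) (by omega)
        (hkey.error_lt hC_nonneg (by omega)) hx⟩

theorem mainTheorem3 (N k : ℕ) (hN : 1 ≤ N) (hk : 12 ≤ k) (f : CuspForm 𝒮ℒ (k : ℤ))
    (hvanish : ∀ n < N, cuspCoeff f n = 0)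
    (hnorm : cuspCoeff f N = 1)
    (hreal : ∀ n, (cuspCoeff f n).im = 0)
    (C : ℝ)
    (hC : ∀ n ≥ N, ‖cuspCoeff f n‖ ≤
      C * (ArithmeticFunction.sigma 0 n : ℝ) * (n : ℝ) ^ (((k : ℝ) - 1) / 2))
    (hkey :
      4 * Real.exp (2 * Real.pi) * C / ((N : ℝ) + 1) ^ ((k : ℝ) / 4)
        + 4 * Real.exp (2 * Real.pi) * C * (2 * Real.pi) ^ (k / 4)
            * (Real.sqrt k * Real.log (2 * k) + 1) / ((k / 4).factorial : ℝ)
        + Real.exp (2 * Real.pi * N) * (2 * Real.pi * N) ^ (k / 4)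
            / ((N : ℝ) ^ (k - 1) * ((k / 4).factorial : ℝ))
      < 1 / (N : ℝ) ^ (k - 1)
          * (Real.exp (-(2 * Real.pi * N))
              - (2 * Real.pi * N) ^ (k / 2) / ((k / 2).factorial : ℝ)
                  * Real.exp (2 * Real.pi * N)))
    (hcrit : TruncExpCriteria (k / 2 - 1) N) :
    ∃ r : ℂ[X], IsPeriodPolynomial f r ∧ IsUnimodular r :=
  mainTheorem3_general hvanish hnorm hreal (norm_cuspCoeff_le_two_mul_pow hnorm hC) hkey
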